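/- **Conventions.** Let $X$ be a connected simplicial complex. For vertices $v,w$ write $v\sim w$ if $v$ and $w$ span a simplex of $X$ ($v=w$ is allowed). The distance $d(v,w)$ of two vertices is the number of edges in a shortest path from $v$ to $w$ in the $1$-skeleton; the ball $B_i(O)$ and the sphere $S_i(O)$ are the full subcomplexes spanned by the vertices at distance at most $i$, respectively exactly $i$, from the vertex $O$. The link $X_\sigma$ of a simplex $\sigma$ consists of the simplices that are disjoint from $\sigma$ and span a simplex together with $\sigma$. - $X$ is *uniformly locally finite* if there is $N$ such that every vertex lies in at most $N$ simplices. - $X$ is *$8$-located* if it is flag and every full homotopically trivial loop (embedded simplicial cycle which is a full subcomplex) of length at most $8$ is contained in a ball of radius $1$. - $X$ (flag) has the *$SD'$-property* if for every vertex $O$ and every $i\ge 1$: (T) for every edge $e$ of $S_{i+1}(O)$ the intersection $X_e\cap B_i(O)$ is non-empty; (V) for every vertex $v\in S_{i+1}(O)$ and all vertices $u,w\in X_v\cap B_i(O)$ there is a vertex $t\in X_v\cap B_i(O)$ with $t\sim u$ and $t\sim w$. - A *simplicial isometry* $h$ of $X$ is a simplicial automorphism of $X$. It is *nonelliptic* if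 it maps no simplex of $X$ onto itself. Its translation length is $|h|=\min_{x\in X^{(0)}} d(h(x),x)$, and $\mathrm{Min}_X(h)$ is the full subcomplex spanned by the vertices $x$ with $d(h(x),x)=|h|$. - An *$h$-invariant geodesic* (axis of $h$) is a map $\gamma:\mathbb Z\to X^{(0)}$ with $d(\gamma(s),\gamma(t))=|s-t|$ for all $s,t$ which $h$ translates non-trivially: there is an integer $a>0$ with $h(\gamma(t))=\gamma(t+a)$ for all $t$. (For nonelliptic $h$ this means, up to the orientation of $\gamma$, just that $h$ maps $\gamma$ onto itself.) **Theorem.** Let $X$ be a connected, uniformly locally finite $8$-located complex with the $SD'$-property, and let $h$ be a nonelliptic simplicial isometry of $X$ with $|h|>3$. Let $n\ge 1$. If there exists an $h^n$-invariant geodesic in $X$, then for every vertex $x\in\mathrm{Min}_X(h^n)$ there exists an $h^n$-invariant geodesic passing through $x$. -/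

import Mathlib

namespace AbstractSimplicialComplex

variable {V : Type*} (X : AbstractSimplicialComplex V)

/-- The set of vertices `A` spans a simplex of `X` (so `A` is finite and non-empty). -/
def IsSimplex (A : Set V) : Prop := ∃ s ∈ X.faces, (s : Set V) = A

/-- The relation `v ∼ w`: the vertices `v` and `w` span a simplex of `X`; `v = w` is allowed. -/
def Near (v w : V) : Prop := X.IsSimplex {v, w}

/-- The `1`-skeleton of `X`, as a graph. -/
def oneSkeleton : SimpleGraph V where
  Adj v w := v ≠ w ∧ X.Near v w
  symm := ⟨fun v w h => ⟨h.1.symm, by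
    obtain ⟨s, hs, hsA⟩ := h.2
    exact ⟨s, hs, hsA.trans (Set.pair_comm v w)⟩⟩⟩
  loopless := ⟨fun _ h => h.1 rfl⟩

/-- The combinatorial metric on the vertices of a connected complex: the number of edges in a
shortest path of the `1`-skeleton. -/
noncomputable def dist (v w : V) : ℕ := X.oneSkeleton.dist v w

/-- The vertices of the ball of radius `i` around `O` (the ball is the full subcomplex spanned by
these vertices). -/
def ballVertices (O : V) (i : ℕ) : Set V := {v | X.dist O v ≤ i}

/-- The vertices of the sphere of radius `i` around `O` (the sphere is the full subcomplex spanned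
by these vertices). -/
def sphereVertices (O : V) (i : ℕ) : Set V := {v | X.dist O v = i}

/-- The vertices of the link of `X` at the simplex `σ`. -/
def linkVertices (σ : Set V) : Set V := {t | t ∉ σ ∧ X.IsSimplex (insert t σ)}

/-- `X` is flag: finitely many vertices pairwise joined by edges span a simplex. -/
def IsFlag : Prop :=
  ∀ s : Finset V, s.Nonempty → (∀ v ∈ s, ∀ w ∈ s, v ≠ w → X.oneSkeleton.Adj v w) → s ∈ X.faces

/-- `X` is uniformly locally finite: the number of simplices containing a given vertex is finite
and bounded independently of the vertex. -/
def UniformlyLocallyFinite : Prop :=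
  ∃ N : ℕ, ∀ v : V, {s : Finset V | s ∈ X.faces ∧ v ∈ s}.encard ≤ N

/-! ### Loops and `m`-location -/

/-- `c` is a cyclic enumeration of the vertices of a cycle of length `k` in `X`, i.e. of a
subcomplex of `X` which is a triangulation of the circle with `k` edges. -/
structure IsCycle (k : ℕ) (c : ZMod k → V) : Prop where
  three_le : 3 ≤ k
  injective : Function.Injective c
  adj : ∀ i, X.oneSkeleton.Adj (c i) (c (i + 1))

/-- A full cycle: every simplex of `X` with vertices on the cycle is a simplex of the cycle. -/
structure IsFullCycle (k : ℕ) (c : ZMod k → V) : Prop extends X.IsCycle k c where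
  full : ∀ s ∈ X.faces, (s : Set V) ⊆ Set.range c → ∃ i, (s : Set V) ⊆ {c i, c (i + 1)}

/-- The elementary moves between edge paths (lists of vertices): a path running through `u, v, w`
in succession, where `u, v, w` are vertices of one simplex, may be replaced by the path that goes
from `u` directly to `w`; a repeated vertex may be deleted. -/
inductive EdgePathStep : List V → List V → Prop
  | triangle (p q : List V) (u v w : V) (h : X.IsSimplex {u, v, w}) :
      EdgePathStep (p ++ u :: v :: w :: q) (p ++ u :: w :: q)
  | stutter (p q : List V) (v : V) : EdgePathStep (p ++ v :: v :: q) (p ++ v :: q)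

/-- Combinatorial homotopy of edge paths relative to their endpoints: the equivalence relation
generated by the elementary moves. -/
def EdgePathHomotopic : List V → List V → Prop := Relation.EqvGen X.EdgePathStep

/-- The closed edge path `c 0, c 1, …, c (k - 1), c 0`. -/
def loopOf (k : ℕ) (c : ZMod k → V) : List V := (List.range (k + 1)).map fun i => c (i : ZMod k)

/-- A loop is homotopically trivial if it is homotopic to a constant path. -/
def IsHomotopicallyTrivial (k : ℕ) (c : ZMod k → V) : Prop :=
  X.EdgePathHomotopic (loopOf k c) [c 0]

/-- `X` is `m`-located: it is flag, and every full homotopically trivial loop of length at most `m`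
is contained in a ball of radius `1`. -/
def IsLocated (m : ℕ) : Prop :=
  X.IsFlag ∧ ∀ (k : ℕ) (c : ZMod k → V), k ≤ m → X.IsFullCycle k c →
    X.IsHomotopicallyTrivial k c → ∃ v, Set.range c ⊆ X.ballVertices v 1

/-! ### The `SD'` property -/

/-- The triangle condition for `O` at level `i`: for every edge `⟨v, w⟩` of the sphere of radius
`i + 1`, its link meets the ball of radius `i`. -/
def TriangleCondition (O : V) (i : ℕ) : Prop :=
  ∀ v ∈ X.sphereVertices O (i + 1), ∀ w ∈ X.sphereVertices O (i + 1), X.oneSkeleton.Adj v w →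
    (X.linkVertices {v, w} ∩ X.ballVertices O i).Nonempty

/-- The vertex condition for `O` at level `i`: any two vertices of the link of a vertex `v` of the
sphere of radius `i + 1` which lie in the ball of radius `i` have there a common neighbour `t` (in
the reflexive sense of `∼`). -/
def VertexCondition (O : V) (i : ℕ) : Prop :=
  ∀ v ∈ X.sphereVertices O (i + 1),
    ∀ u ∈ X.linkVertices {v} ∩ X.ballVertices O i, ∀ w ∈ X.linkVertices {v} ∩ X.ballVertices O i,
      ∃ t ∈ X.linkVertices {v} ∩ X.ballVertices O i, X.Near t u ∧ X.Near t w

/-- The property `SD'ₙ(O)`. -/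
def SDn (n : ℕ) (O : V) : Prop :=
  ∀ i, 1 ≤ i → i ≤ n → X.TriangleCondition O i ∧ X.VertexCondition O i

/-- The property `SD'`. -/
def SD : Prop := ∀ (n : ℕ) (O : V), X.SDn n O

/-! ### Isometries -/

/-- A simplicial isometry of `X`: a simplicial automorphism, given by its action on vertices. -/
def IsSimplicialIsometry (h : Equiv.Perm V) : Prop :=
  ∀ s : Finset V, s.map h.toEmbedding ∈ X.faces ↔ s ∈ X.faces

/-- `h` is elliptic if it maps some simplex of `X` onto itself. -/
def IsElliptic (h : Equiv.Perm V) : Prop := ∃ s ∈ X.faces, s.map h.toEmbedding = s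

/-- The displacement function `d_h`. -/
noncomputable def displacement (h : Equiv.Perm V) (x : V) : ℕ := X.dist (h x) x

/-- The translation length `|h|`, the minimum of the displacement function. -/
noncomputable def translationLength (h : Equiv.Perm V) : ℕ := ⨅ x, X.displacement h x

/-- The vertices of the minimal displacement set `Min_X(h)`. -/
def minVertices (h : Equiv.Perm V) : Set V := {x | X.displacement h x = X.translationLength h}

/-- `γ` is a (bi-infinite) geodesic of `X`. -/
def IsGeodesicLine (γ : ℤ → V) : Prop := ∀ a b : ℤ, (X.dist (γ a) (γ b) : ℤ) = |a - b|

/-- `γ` is a `g`-invariant geodesic (an axis of `g`): a bi-infinite geodesic which `g` maps to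
itself, translating it non-trivially. For a nonelliptic `g` the second clause only says that `g`
maps `γ` onto itself (up to the orientation of `γ`), see `isInvariantGeodesic_of_image_eq`. -/
def IsInvariantGeodesic (g : Equiv.Perm V) (γ : ℤ → V) : Prop :=
  X.IsGeodesicLine γ ∧ ∃ a : ℤ, 0 < a ∧ ∀ t, g (γ t) = γ (t + a)

section InvariantGeodesic

variable {X}

theorem IsSimplicialIsometry.adj_iff {g : Equiv.Perm V} (hg : X.IsSimplicialIsometry g) (v w : V) :
    X.oneSkeleton.Adj (g v) (g w) ↔ X.oneSkeleton.Adj v w := by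
  have key : X.Near (g v) (g w) ↔ X.Near v w := by
    constructor
    · rintro ⟨s, hs, hsA⟩
      refine ⟨s.map g.symm.toEmbedding, ?_, ?_⟩
      · rw [← hg]
        convert hs using 1
        ext x
        simp
      · ext x
        have hx := Set.ext_iff.1 hsA (g x)
        simpa [Equiv.symm_apply_eq] using hx
    · rintro ⟨s, hs, hsA⟩
      refine ⟨s.map g.toEmbedding, (hg s).2 hs, ?_⟩
      rw [Finset.coe_map, hsA]
      simp [Set.image_pair]
  change (g v ≠ g w ∧ _) ↔ (v ≠ w ∧ _)
  rw [key, g.injective.ne_iff]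

theorem IsSimplicialIsometry.dist_eq {g : Equiv.Perm V} (hg : X.IsSimplicialIsometry g) (v w : V) :
    X.dist (g v) (g w) = X.dist v w := by
  let e : X.oneSkeleton ≃g X.oneSkeleton := ⟨g, fun {a b} => hg.adj_iff a b⟩
  unfold dist
  rw [SimpleGraph.dist_eq_sInf, SimpleGraph.dist_eq_sInf]
  congr 1
  ext k
  constructor
  · rintro ⟨p, rfl⟩
    exact ⟨(p.map e.symm.toHom).copy (e.symm_apply_apply v) (e.symm_apply_apply w), by simp⟩
  · rintro ⟨p, rfl⟩
    exact ⟨p.map e.toHom, by simp⟩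

/-- A geodesic mapped onto itself by a nonelliptic simplicial isometry is, for one of its two
orientations, an invariant geodesic. -/
theorem isInvariantGeodesic_of_image_eq {g : Equiv.Perm V} (hg : X.IsSimplicialIsometry g)
    (hell : ¬ X.IsElliptic g) {γ : ℤ → V} (hγ : X.IsGeodesicLine γ)
    (him : g '' Set.range γ = Set.range γ) :
    X.IsInvariantGeodesic g γ ∨ X.IsInvariantGeodesic g (fun t => γ (-t)) := by
  have hex : ∀ t, ∃ s, γ s = g (γ t) := fun t => by
    have : g (γ t) ∈ Set.range γ := him ▸ ⟨γ t, ⟨t, rfl⟩, rfl⟩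
    exact this
  choose φ hφ using hex
  have hφd : ∀ a b, |φ a - φ b| = |a - b| := fun a b => by
    rw [← hγ, ← hγ, hφ, hφ, hg.dist_eq]
  have hfix : ∀ t, g (γ t) ≠ γ t := fun t ht =>
    hell ⟨{γ t}, X.singleton_mem _, by simp [ht]⟩
  have h1 := hφd 1 0
  have hcase : (∀ t, φ t = t + φ 0) ∨ (∀ t, φ t = φ 0 - t) := by
    rcases (abs_eq (by norm_num : (0 : ℤ) ≤ 1)).1 (h1.trans (by norm_num)) with h | h
    · left
      intro t
      have h2 := hφd t 0
      have h3 := hφd t 1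
      rw [abs_eq_abs] at h2 h3
      omega
    · right
      intro t
      have h2 := hφd t 0
      have h3 := hφd t 1
      rw [abs_eq_abs] at h2 h3
      omega
  rcases hcase with hc | hc
  · have h0 : φ 0 ≠ 0 := fun h => hfix 0 (by rw [← hφ, h])
    rcases lt_or_gt_of_ne h0 with h | h
    · right
      refine ⟨fun a b => ?_, -φ 0, by omega, fun t => ?_⟩
      · rw [hγ, abs_sub_comm]
        congr 1
        ring
      · rw [← hφ, hc]
        congr 1
        ring
    · left
      exact ⟨hγ, φ 0, h, fun t => by rw [← hφ, hc]⟩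
  · exfalso
    obtain ⟨m, hm | hm⟩ := Int.even_or_odd' (φ 0)
    · exact hfix m (by rw [← hφ, hc, hm]; congr 1; ring)
    · have e1 : g (γ m) = γ (m + 1) := by rw [← hφ, hc, hm]; congr 1; ring
      have e2 : g (γ (m + 1)) = γ m := by rw [← hφ, hc, hm]; congr 1; ring
      have hd : X.oneSkeleton.dist (γ m) (γ (m + 1)) = 1 := by
        have := hγ m (m + 1)
        simp only [sub_add_cancel_left, abs_neg, abs_one] at this
        exact_mod_cast this
      obtain ⟨-, s, hs, hsA⟩ := SimpleGraph.dist_eq_one_iff_adj.1 hd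
      refine hell ⟨s, hs, Finset.coe_injective ?_⟩
      rw [Finset.coe_map, hsA]
      simp [Set.image_pair, e1, e2, Set.pair_comm]

end InvariantGeodesic

end AbstractSimplicialComplex

/-!
Write `g = h ^ n`, and let `a` be the amount by which `g` translates the given axis. A vertex `y` of
the axis satisfies `d(y, g ^ k y) = k * a` for all `k`. For an arbitrary vertex `x` the numbers
`d(x, g ^ k x)` and `d(y, g ^ k y)` differ by at most `2 * d(x, y)`, independently of `k`, and
`k ↦ d(x, g ^ k x)` is subadditive; hence `d(x, g ^ k x) ≥ k * a` for all `x` and `k`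
(`SimpleGraph.mul_le_dist_pow_apply`). So the translation length of `g` is `a`, and it is
multiplicative along the powers of `g`.

If `x` is displaced minimally, i.e. `d(x, g x) = a`, take a geodesic from `x` to `g x` and
concatenate its translates under the powers of `g`. The part of the resulting `g`-invariant path
between `g ^ (-N) x` and `g ^ N x` has length `2 * N * a`, which is the distance of its endpoints.
Thus the path is geodesic on arbitrarily long segments, and so it is an axis through `x`
(`SimpleGraph.exists_translated_geodesic_line`).
-/

namespace SimpleGraph

variable {V : Type*} {G : SimpleGraph V} {g : Equiv.Perm V}

theorem dist_pow_apply_apply (hg : ∀ v w, G.dist (g v) (g w) = G.dist v w) (k : ℕ) (v w : V) :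
    G.dist ((g ^ k) v) ((g ^ k) w) = G.dist v w := by
  induction k with
  | zero => rfl
  | succ k ih => rw [pow_succ', Equiv.Perm.mul_apply, Equiv.Perm.mul_apply, hg, ih]

theorem dist_zpow_apply_apply (hg : ∀ v w, G.dist (g v) (g w) = G.dist v w) (k : ℤ) (v w : V) :
    G.dist ((g ^ k) v) ((g ^ k) w) = G.dist v w := by
  obtain ⟨m, rfl | rfl⟩ := k.eq_nat_or_neg
  · simpa using dist_pow_apply_apply hg m v w
  · have := dist_pow_apply_apply hg m ((g ^ (-(m : ℤ))) v) ((g ^ (-(m : ℤ))) w)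
    rw [← Equiv.Perm.mul_apply, ← Equiv.Perm.mul_apply, ← zpow_natCast, ← zpow_add, add_neg_cancel,
      zpow_zero] at this
    exact this.symm

theorem dist_pow_apply_le (hconn : G.Connected) (hg : ∀ v w, G.dist (g v) (g w) = G.dist v w)
    (x : V) (k : ℕ) : G.dist x ((g ^ k) x) ≤ k * G.dist x (g x) := by
  induction k with
  | zero => simp
  | succ k ih =>
    have h1 := hconn.dist_triangle (u := x) (v := (g ^ k) x) (w := (g ^ (k + 1)) x)
    have h2 : G.dist ((g ^ k) x) ((g ^ (k + 1)) x) = G.dist x (g x) := by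
      rw [pow_succ, Equiv.Perm.mul_apply, dist_pow_apply_apply hg]
    rw [add_mul, one_mul]
    omega

/-- Stability of the translation length: if the powers of `g` displace some vertex `y` linearly,
with slope `a`, then they displace every vertex at least that much. -/
theorem mul_le_dist_pow_apply (hconn : G.Connected)
    (hg : ∀ v w, G.dist (g v) (g w) = G.dist v w) {y : V} {a : ℕ}
    (hy : ∀ k : ℕ, G.dist y ((g ^ k) y) = k * a) (x : V) (k : ℕ) :
    k * a ≤ G.dist x ((g ^ k) x) := by
  by_contra! hlt
  -- A deficit of at least one for `g ^ k` adds up to `m` for `g ^ (k * m)`; it must not exceed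
  -- `2 * G.dist y x`, so this `m` is large enough for a contradiction.
  set m := 2 * G.dist y x + 1 with hm
  have h1 := dist_pow_apply_le hconn (dist_pow_apply_apply hg k) x m
  rw [← pow_mul] at h1
  have h2 := hy (k * m)
  have h3 := hconn.dist_triangle (u := y) (v := x) (w := (g ^ (k * m)) y)
  have h4 := hconn.dist_triangle (u := x) (v := (g ^ (k * m)) x) (w := (g ^ (k * m)) y)
  rw [dist_pow_apply_apply hg, G.dist_comm (u := x) (v := y)] at h4
  have h5 : m * (G.dist x ((g ^ k) x) + 1) ≤ m * (k * a) := Nat.mul_le_mul_left m hlt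
  rw [mul_add, mul_one] at h5
  have h6 : k * m * a = m * (k * a) := by ring
  omega

/-- A sequence of vertices with steps of length at most one is a geodesic line as soon as
arbitrarily long segments of it realize the distance of their endpoints. -/
theorem dist_eq_abs_sub_of_segments (hconn : G.Connected) {γ : ℤ → V}
    (hstep : ∀ t, G.dist (γ t) (γ (t + 1)) ≤ 1)
    (hseg : ∀ N : ℕ, ∃ s t : ℤ, s ≤ -N ∧ N ≤ t ∧ t - s ≤ G.dist (γ s) (γ t)) (s t : ℤ) :
    (G.dist (γ s) (γ t) : ℤ) = |s - t| := by
  have hle : ∀ (s : ℤ) (m : ℕ), G.dist (γ s) (γ (s + m)) ≤ m := by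
    intro s m
    induction m with
    | zero => simp
    | succ m ih =>
      have h1 := hconn.dist_triangle (u := γ s) (v := γ (s + m)) (w := γ (s + m + 1))
      have h2 := hstep (s + m)
      push_cast
      rw [← add_assoc]
      omega
  have hle' : ∀ s t : ℤ, s ≤ t → (G.dist (γ s) (γ t) : ℤ) ≤ t - s := by
    intro s t hst
    have := hle s (t - s).toNat
    rw [Int.toNat_of_nonneg (by omega), add_sub_cancel] at this
    omega
  have heq : ∀ s t : ℤ, s ≤ t → (G.dist (γ s) (γ t) : ℤ) = t - s := by
    intro s t hst
    obtain ⟨p, q, hp, hq, hpq⟩ := hseg (s.natAbs + t.natAbs)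
    have h1 := hle' s t hst
    have h2 := hle' p s (by omega)
    have h3 := hle' t q (by omega)
    have h4 := hconn.dist_triangle (u := γ p) (v := γ s) (w := γ q)
    have h5 := hconn.dist_triangle (u := γ s) (v := γ t) (w := γ q)
    omega
  rcases le_total s t with hst | hst
  · rw [heq s t hst, abs_sub_comm, abs_of_nonneg (by omega)]
  · rw [G.dist_comm, heq t s hst, abs_of_nonneg (by omega)]

/-- The translates under the powers of `g` of a geodesic from `x` to `g x` form a geodesic line
if the displacement of `x` is multiplicative along the powers of `g`. -/
theorem exists_translated_geodesic_line (hconn : G.Connected)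
    (hg : ∀ v w, G.dist (g v) (g w) = G.dist v w) {x : V} {a : ℕ} (ha : 0 < a)
    (hx : ∀ k : ℕ, G.dist x ((g ^ k) x) = k * a) :
    ∃ γ : ℤ → V, γ 0 = x ∧ (∀ t, g (γ t) = γ (t + a)) ∧
      ∀ s t, (G.dist (γ s) (γ t) : ℤ) = |s - t| := by
  obtain ⟨p, hp⟩ := hconn.exists_walk_length_eq_dist x (g x)
  have hpa : p.length = a := by simpa [hp] using hx 1
  have ha' : (a : ℤ) ≠ 0 := by omega
  let γ : ℤ → V := fun t => (g ^ (t / a)) (p.getVert (t % a).toNat)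
  have hmul : ∀ k : ℤ, γ (k * a) = (g ^ k) x := fun k => by
    simp [γ, Int.mul_ediv_cancel k ha']
  refine ⟨γ, by simpa using hmul 0, fun t => ?_, ?_⟩
  · simp only [γ]
    rw [Int.add_ediv_of_dvd_right (dvd_refl _), Int.ediv_self ha', Int.add_emod_right, add_comm,
      zpow_add, zpow_one, Equiv.Perm.mul_apply]
  · refine dist_eq_abs_sub_of_segments hconn (fun t => ?_) fun N => ?_
    · obtain ⟨q, r, hr, hra, rfl⟩ : ∃ (q : ℤ) (r : ℕ), (r : ℤ) = t % a ∧ r < a ∧ t = r + a * q :=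
        have h0 := Int.emod_nonneg t ha'
        have h1 := Int.emod_lt_of_pos t (by omega : (0 : ℤ) < a)
        ⟨t / a, (t % a).toNat, by omega, by omega, by
          rw [Int.toNat_of_nonneg h0]; exact (Int.emod_add_mul_ediv t a).symm⟩
      have hγ : ∀ i : ℕ, i ≤ a → γ (i + a * q) = (g ^ q) (p.getVert i) := by
        intro i hi
        rcases hi.lt_or_eq with hi | rfl
        · simp only [γ]
          rw [Int.add_mul_ediv_left _ _ ha', Int.add_mul_emod_self_left,
            Int.ediv_eq_zero_of_lt (by omega) (by omega), Int.emod_eq_of_lt (by omega) (by omega),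
            zero_add, Int.toNat_natCast]
        · have := hmul (q + 1)
          rw [zpow_add, zpow_one, Equiv.Perm.mul_apply] at this
          rw [← hpa, p.getVert_length, ← this, hpa]
          congr 1
          ring
      have hsucc := hγ (r + 1) hra
      have hadj := p.adj_getVert_succ (i := r) (by omega)
      rw [hγ r hra.le, show (r : ℤ) + a * q + 1 = ((r + 1 : ℕ) : ℤ) + a * q by push_cast; ring,
        hsucc, dist_zpow_apply_apply hg]
      exact (dist_eq_one_iff_adj.2 hadj).le
    · have hN : (N : ℤ) ≤ N * a := by exact_mod_cast Nat.le_mul_of_pos_right N ha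
      refine ⟨-N * a, N * a, by rw [neg_mul]; omega, hN, ?_⟩
      have h1 := dist_zpow_apply_apply hg N ((g ^ (-(N : ℤ))) x) ((g ^ (N : ℤ)) x)
      have h2 := hx (2 * N)
      rw [← Equiv.Perm.mul_apply, ← Equiv.Perm.mul_apply, ← zpow_add, ← zpow_add, add_neg_cancel,
        zpow_zero, Equiv.Perm.one_apply, ← Nat.cast_add, zpow_natCast, ← two_mul, h2] at h1
      rw [hmul, hmul, ← h1]
      push_cast
      linarith

end SimpleGraph

theorem theorem3p10 {V : Type*} (X : AbstractSimplicialComplex V)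
    (hconn : X.oneSkeleton.Connected) (hfin : X.UniformlyLocallyFinite)
    (hloc : X.IsLocated 8) (hSD : X.SD)
    (h : Equiv.Perm V) (hiso : X.IsSimplicialIsometry h)
    (hell : ¬ X.IsElliptic h) (hlen : 3 < X.translationLength h)
    (n : ℕ) (hn : 1 ≤ n) (haxis : ∃ γ : ℤ → V, X.IsInvariantGeodesic (h ^ n) γ) :
    ∀ x ∈ X.minVertices (h ^ n),
      ∃ γ : ℤ → V, X.IsInvariantGeodesic (h ^ n) γ ∧ x ∈ Set.range γ := by
  intro x hx
  have hg := SimpleGraph.dist_pow_apply_apply (G := X.oneSkeleton) hiso.dist_eq n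
  generalize h ^ n = g at *
  obtain ⟨η, hη, b, hb, hshift⟩ := haxis
  obtain ⟨a, rfl⟩ := Int.eq_ofNat_of_zero_le hb.le
  have hpow : ∀ k : ℕ, (g ^ k) (η 0) = η (k * a) := by
    intro k
    induction k with
    | zero => simp
    | succ k ih =>
      rw [pow_succ', Equiv.Perm.mul_apply, ih, hshift]
      congr 1
      push_cast
      ring
  have hlin : ∀ k : ℕ, X.oneSkeleton.dist (η 0) ((g ^ k) (η 0)) = k * a := by
    intro k
    have := hη 0 (k * a)
    rw [zero_sub, abs_neg, abs_of_nonneg (by positivity)] at this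
    rw [hpow]
    exact_mod_cast this
  have hlower := SimpleGraph.mul_le_dist_pow_apply hconn hg hlin x
  have hxa : X.oneSkeleton.dist x (g x) ≤ a := by
    have h1 : X.displacement g x ≤ X.displacement g (η 0) :=
      hx.trans_le (ciInf_le (OrderBot.bddBelow _) (η 0))
    have h2 := hlin 1
    rw [pow_one, one_mul] at h2
    rw [SimpleGraph.dist_comm, ← h2, SimpleGraph.dist_comm (u := η 0)]
    exact h1
  obtain ⟨γ, h0, hγg, hγ⟩ := SimpleGraph.exists_translated_geodesic_line hconn hg
    (by exact_mod_cast hb) fun k => le_antisymm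
      ((SimpleGraph.dist_pow_apply_le hconn hg x k).trans (Nat.mul_le_mul_left k hxa)) (hlower k)
  exact ⟨γ, ⟨hγ, a, hb, hγg⟩, 0, h0⟩
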